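/- A group $G$ is called poly-free if it admits a finite chain of subgroups $1=G_0\unlhd G_1\unlhd\cdots\unlhd G_n=G$ such that each quotient $G_i/G_{i-1}$ is a free group of possibly infinite rank (the trivial group is free of rank $0$); it is called normally poly-free if such a chain can be chosen with every $G_i$ normal in $G$. The minimal such $n$ is the poly-free (resp. normally poly-free) length of $G$. A group is virtually poly-free (resp. virtually normally poly-free) if it has a subgroup of finite index that is poly-free (resp. normally poly-free). Let $(G_i)_{i\in I}$ be a family of groups indexed by an arbitrary set $I$, and let $\ast_{i\in I}G_i$ be its free product. 1. For every $n\ge 0$: if each $G_i$ is poly-free of length at most $n$, then $\ast_{i\in I}G_i$ is poly-free of length at most $n$. 2. For every $n\ge 0$: if each $G_i$ is normally poly-free of normally poly-free length at most $n$, then $\ast_{i\in I}G_i$ is normally poly-free of normally poly-free length at most $n$. 3. If $I$ is finite and each $G_i$ is virtually poly-free, then $\ast_{i\in I}G_i$ is virtually poly-free. 4. If $I$ is finite and each $G_i$ is virtually normally poly-free, then $\ast_{i\in I}G_i$ is virtually normally poly-free. -/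

import Mathlib

/-- A chain of subgroups `1 = H 0 ⊴ H 1 ⊴ ⋯ ⊴ H n = G` such that each successive quotient
`H (i+1) / H i` is a free group, of arbitrary (possibly zero, possibly infinite) rank. -/
def IsPolyFreeChain {G : Type*} [Group G] {n : ℕ} (H : Fin (n + 1) → Subgroup G) : Prop :=
  H 0 = ⊥ ∧ H (Fin.last n) = ⊤ ∧
    ∀ i : Fin n, H i.castSucc ≤ H i.succ ∧
      ∃ _ : ((H i.castSucc).subgroupOf (H i.succ)).Normal,
        IsFreeGroup (↥(H i.succ) ⧸ (H i.castSucc).subgroupOf (H i.succ))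

/-- `G` admits a poly-free chain with `n` steps. -/
def HasPolyFreeChain (G : Type*) [Group G] (n : ℕ) : Prop :=
  ∃ H : Fin (n + 1) → Subgroup G, IsPolyFreeChain H

/-- `G` admits a poly-free chain with `n` steps all of whose terms are normal in `G`. -/
def HasNormalPolyFreeChain (G : Type*) [Group G] (n : ℕ) : Prop :=
  ∃ H : Fin (n + 1) → Subgroup G, IsPolyFreeChain H ∧ ∀ i, (H i).Normal

/-- Poly-free groups. -/
def IsPolyFree (G : Type*) [Group G] : Prop :=
  ∃ n, HasPolyFreeChain G n

/-- Normally poly-free groups. -/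
def IsNormallyPolyFree (G : Type*) [Group G] : Prop :=
  ∃ n, HasNormalPolyFreeChain G n

/-- The poly-free length of `G`: the minimal number of steps of a poly-free chain
(meaningful for poly-free groups only). -/
noncomputable def polyFreeLength (G : Type*) [Group G] : ℕ :=
  sInf {n | HasPolyFreeChain G n}

/-- The normally poly-free length of `G`: the minimal number of steps of a poly-free chain
of normal subgroups (meaningful for normally poly-free groups only). -/
noncomputable def normallyPolyFreeLength (G : Type*) [Group G] : ℕ :=
  sInf {n | HasNormalPolyFreeChain G n}

/-- `G` has a poly-free subgroup of finite index. -/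
def IsVirtuallyPolyFree (G : Type*) [Group G] : Prop :=
  ∃ K : Subgroup G, K.FiniteIndex ∧ IsPolyFree K

/-- `G` has a normally poly-free subgroup of finite index. -/
def IsVirtuallyNormallyPolyFree (G : Type*) [Group G] : Prop :=
  ∃ K : Subgroup G, K.FiniteIndex ∧ IsNormallyPolyFree K

/-!
Let `θ : ∗ G i → X` be a homomorphism with restrictions `θ i : G i → X`. Its kernel embeds in
`(∗ ker (θ i)) ∗ F` with `F` free: the Kaloujnine–Krasner maps `G i → ker (θ i) ≀ X`, conjugated by
free generators of `F`, extend to the free product, and the coordinate at `1` of the extension is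
a homomorphism on `ker θ`, which is injective because the inclusions of the `ker (θ i)` and a
suitable choice of images of the generators of `F` give a left inverse.

Together with Nielsen–Schreier, this gives the poly-free case by induction on the length, applied
to `∗ G i → ∗ G i / N i` with `G i / N i` the top quotient of a chain of `G i`. For normal chains
`C i k`, the kernels of `∗ G i → ∗ G i / C i k` form a chain: each quotient is the kernel of
`∗ G i / C i k → ∗ G i / C i (k + 1)`, which embeds in a free group. For finite `I`, finite index
normal subgroups `N i` are the kernels of maps to the finite group `∏ G i / N i`, and so a subgroup
of finite index of `∗ G i` embeds in `(∗ N i) ∗ F`.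
-/

open Function Monoid
open scoped Monoid.Coprod

universe u v

section FreeQuotients

variable {G H : Type*} [Group G] [Group H]

theorem isFreeGroup_of_injective [IsFreeGroup H] (f : G →* H) (hf : Injective f) :
    IsFreeGroup G :=
  .ofMulEquiv (MonoidHom.ofInjective hf).symm

/-- One step of a poly-free chain: `A` is a normal subgroup of `B` with free quotient `B / A`. -/
def HasFreeQuotient (A B : Subgroup G) : Prop :=
  A ≤ B ∧ ∃ _ : (A.subgroupOf B).Normal, IsFreeGroup (↥B ⧸ A.subgroupOf B)

theorem hasFreeQuotient_iff_isFreeGroup_range {A B : Subgroup G} (hAB : A ≤ B) (g : B →* H)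
    (hg : g.ker = A.subgroupOf B) : HasFreeQuotient A B ↔ IsFreeGroup g.range := by
  rw [HasFreeQuotient, ← hg]
  have e := QuotientGroup.quotientKerEquivRange g
  exact ⟨fun ⟨_, _, _⟩ => .ofMulEquiv e, fun _ => ⟨hAB, inferInstance, .ofMulEquiv e.symm⟩⟩

theorem HasFreeQuotient.of_hom {A B : Subgroup G} [IsFreeGroup H] (hAB : A ≤ B) (g : B →* H)
    (hg : g.ker = A.subgroupOf B) : HasFreeQuotient A B :=
  (hasFreeQuotient_iff_isFreeGroup_range hAB g hg).2 inferInstance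

theorem HasFreeQuotient.refl (A : Subgroup G) : HasFreeQuotient A A :=
  .of_hom le_rfl (1 : A →* FreeGroup Empty) (by simp)

theorem hasFreeQuotient_top_iff {N : Subgroup G} :
    HasFreeQuotient N ⊤ ↔ ∃ _ : N.Normal, IsFreeGroup (G ⧸ N) := by
  constructor
  · rintro ⟨-, hN, hfree⟩
    have : N.Normal := Subgroup.normalizer_eq_top_iff.1
      (top_le_iff.1 ((Subgroup.normal_subgroupOf_iff_le_normalizer le_top).1 hN))
    have e : (⊤ : Subgroup G) ⧸ N.subgroupOf ⊤ ≃* G ⧸ N :=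
      QuotientGroup.congr _ _ Subgroup.topEquiv
        ((Subgroup.subgroupOf_map_subtype N ⊤).trans (inf_top_eq N))
    exact ⟨this, .ofMulEquiv e⟩
  · rintro ⟨hN, hfree⟩
    refine .of_hom le_top ((QuotientGroup.mk' N).comp (Subgroup.subtype ⊤)) ?_
    rw [← MonoidHom.comap_ker, QuotientGroup.ker_mk', Subgroup.comap_subtype]

theorem HasFreeQuotient.comap {A B : Subgroup H} (h : HasFreeQuotient A B) (f : G →* H) :
    HasFreeQuotient (A.comap f) (B.comap f) := by
  obtain ⟨hAB, hA, hfree⟩ := h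
  refine .of_hom (Subgroup.comap_mono hAB)
    ((QuotientGroup.mk' (A.subgroupOf B)).comp (f.subgroupComap B)) ?_
  rw [← MonoidHom.comap_ker, QuotientGroup.ker_mk']
  rfl

theorem HasFreeQuotient.map {A B : Subgroup G} (h : HasFreeQuotient A B) {f : G →* H}
    (hf : Injective f) : HasFreeQuotient (A.map f) (B.map f) := by
  obtain ⟨hAB, hA, hfree⟩ := h
  let e := B.equivMapOfInjective f hf
  refine .of_hom (Subgroup.map_mono hAB)
    ((QuotientGroup.mk' (A.subgroupOf B)).comp e.symm.toMonoidHom) ?_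
  ext b
  obtain ⟨b, rfl⟩ := e.surjective b
  simp [e, Subgroup.mem_subgroupOf, Subgroup.mem_map_iff_mem hf]

theorem hasFreeQuotient_ker_comp_iff {K : Type*} [Group K] {f : G →* H} (hf : Surjective f)
    (g : H →* K) : HasFreeQuotient f.ker (g.comp f).ker ↔ IsFreeGroup g.ker := by
  have hker : f.ker ≤ (g.comp f).ker := fun a (ha : f a = 1) => by simp [MonoidHom.mem_ker, ha]
  let φ : (g.comp f).ker →* g.ker := f.subgroupComap g.ker
  have hφ : φ.range = ⊤ := MonoidHom.range_eq_top.2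
    (f.subgroupComap_surjective_of_surjective g.ker hf)
  have hφker : φ.ker = f.ker.subgroupOf (g.comp f).ker := by
    ext
    exact Subtype.ext_iff
  rw [hasFreeQuotient_iff_isFreeGroup_range hker φ hφker, hφ]
  exact ⟨fun _ => .ofMulEquiv Subgroup.topEquiv, fun _ => .ofMulEquiv Subgroup.topEquiv.symm⟩

end FreeQuotients

section Chains

variable {G H : Type*} [Group G] [Group H] {n m : ℕ}

theorem isPolyFreeChain_iff {C : Fin (n + 1) → Subgroup G} :
    IsPolyFreeChain C ↔
      C 0 = ⊥ ∧ C (Fin.last n) = ⊤ ∧ ∀ i : Fin n, HasFreeQuotient (C i.castSucc) (C i.succ) :=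
  Iff.rfl

theorem IsPolyFreeChain.comap {C : Fin (n + 1) → Subgroup H} (hC : IsPolyFreeChain C)
    {f : G →* H} (hf : Injective f) : IsPolyFreeChain fun i => (C i).comap f := by
  obtain ⟨hbot, htop, hstep⟩ := isPolyFreeChain_iff.1 hC
  refine isPolyFreeChain_iff.2 ⟨?_, ?_, fun i => (hstep i).comap f⟩
  · rw [hbot, MonoidHom.comap_bot, f.ker_eq_bot_iff.2 hf]
  · rw [htop, Subgroup.comap_top]

theorem HasPolyFreeChain.of_injective (h : HasPolyFreeChain H n) (f : G →* H)
    (hf : Injective f) : HasPolyFreeChain G n :=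
  let ⟨_, hC⟩ := h
  ⟨_, hC.comap hf⟩

theorem HasNormalPolyFreeChain.of_injective (h : HasNormalPolyFreeChain H n) (f : G →* H)
    (hf : Injective f) : HasNormalPolyFreeChain G n :=
  let ⟨_, hC, hN⟩ := h
  ⟨_, hC.comap hf, fun i => (hN i).comap f⟩

theorem IsPolyFreeChain.pad {C : Fin (n + 1) → Subgroup G} (hC : IsPolyFreeChain C)
    (hnm : n ≤ m) : IsPolyFreeChain fun i : Fin (m + 1) => C ⟨min i n, by omega⟩ := by
  obtain ⟨hbot, htop, hstep⟩ := isPolyFreeChain_iff.1 hC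
  refine isPolyFreeChain_iff.2 ⟨by simpa using hbot, ?_, fun i => ?_⟩
  · simp only [Fin.val_last, min_eq_right hnm]
    exact htop
  · obtain hi | hi := lt_or_ge i.1 n
    · simp only [Fin.val_castSucc, Fin.val_succ, min_eq_left hi.le,
        min_eq_left (Nat.succ_le_of_lt hi)]
      exact hstep ⟨i, hi⟩
    · simp only [Fin.val_castSucc, Fin.val_succ, min_eq_right hi,
        min_eq_right (hi.trans (Nat.le_succ _))]
      exact .refl _

theorem HasPolyFreeChain.mono (h : HasPolyFreeChain G n) (hnm : n ≤ m) : HasPolyFreeChain G m :=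
  let ⟨_, hC⟩ := h
  ⟨_, hC.pad hnm⟩

theorem HasNormalPolyFreeChain.mono (h : HasNormalPolyFreeChain G n) (hnm : n ≤ m) :
    HasNormalPolyFreeChain G m :=
  let ⟨_, hC, hN⟩ := h
  ⟨_, hC.pad hnm, fun _ => hN _⟩

theorem HasNormalPolyFreeChain.hasPolyFreeChain (h : HasNormalPolyFreeChain G n) :
    HasPolyFreeChain G n :=
  let ⟨C, hC, _⟩ := h
  ⟨C, hC⟩

theorem isPolyFree_and_polyFreeLength_le_iff :
    IsPolyFree G ∧ polyFreeLength G ≤ n ↔ HasPolyFreeChain G n :=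
  ⟨fun ⟨h, hn⟩ => HasPolyFreeChain.mono (Nat.sInf_mem h) hn, fun h => ⟨⟨n, h⟩, Nat.sInf_le h⟩⟩

theorem isNormallyPolyFree_and_normallyPolyFreeLength_le_iff :
    IsNormallyPolyFree G ∧ normallyPolyFreeLength G ≤ n ↔ HasNormalPolyFreeChain G n :=
  ⟨fun ⟨h, hn⟩ => HasNormalPolyFreeChain.mono (Nat.sInf_mem h) hn,
    fun h => ⟨⟨n, h⟩, Nat.sInf_le h⟩⟩

theorem hasPolyFreeChain_zero_iff : HasPolyFreeChain G 0 ↔ Subsingleton G := by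
  constructor
  · rintro ⟨C, hbot, htop, -⟩
    exact Subgroup.subsingleton_iff.1 (subsingleton_of_bot_eq_top (hbot.symm.trans htop))
  · intro
    exact ⟨fun _ => ⊥, rfl, Subsingleton.elim _ _, fun i => i.elim0⟩

theorem hasPolyFreeChain_succ_iff :
    HasPolyFreeChain G (n + 1) ↔
      ∃ (N : Subgroup G) (_ : N.Normal), IsFreeGroup (G ⧸ N) ∧ HasPolyFreeChain N n := by
  constructor
  · rintro ⟨C, hC⟩
    obtain ⟨hbot, htop, hstep⟩ := isPolyFreeChain_iff.1 hC
    have hlast := hstep (Fin.last n)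
    rw [Fin.succ_last, htop] at hlast
    obtain ⟨hN, hfree⟩ := hasFreeQuotient_top_iff.1 hlast
    refine ⟨_, hN, hfree, fun i => (C i.castSucc).subgroupOf _, isPolyFreeChain_iff.2
      ⟨?_, Subgroup.subgroupOf_self _, fun i => (hstep i.castSucc).comap (Subgroup.subtype _)⟩⟩
    rw [Fin.castSucc_zero, hbot, Subgroup.bot_subgroupOf]
  · rintro ⟨N, hN, hfree, C, hC⟩
    obtain ⟨hbot, htop, hstep⟩ := isPolyFreeChain_iff.1 hC
    refine ⟨Fin.snoc (fun i => (C i).map N.subtype) ⊤, isPolyFreeChain_iff.2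
      ⟨?_, Fin.snoc_last .., Fin.lastCases ?_ fun i => ?_⟩⟩
    · rw [← Fin.castSucc_zero, Fin.snoc_castSucc, hbot, Subgroup.map_bot]
    · rw [Fin.succ_last, Fin.snoc_last, Fin.snoc_castSucc, htop, ← MonoidHom.range_eq_map,
        Subgroup.range_subtype]
      exact hasFreeQuotient_top_iff.2 ⟨hN, hfree⟩
    · rw [Fin.succ_castSucc, Fin.snoc_castSucc, Fin.snoc_castSucc]
      exact (hstep i).map N.subtype_injective

theorem HasPolyFreeChain.of_ker [IsFreeGroup H] (f : G →* H) (h : HasPolyFreeChain f.ker n) :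
    HasPolyFreeChain G (n + 1) :=
  hasPolyFreeChain_succ_iff.2
    ⟨f.ker, inferInstance, isFreeGroup_of_injective _ (QuotientGroup.kerLift_injective f), h⟩

theorem HasPolyFreeChain.isFreeGroup (h : HasPolyFreeChain G 1) : IsFreeGroup G := by
  obtain ⟨N, hN, hfree, hzero⟩ := hasPolyFreeChain_succ_iff.1 h
  have := hasPolyFreeChain_zero_iff.1 hzero
  obtain rfl := N.eq_bot_of_subsingleton
  exact .ofMulEquiv QuotientGroup.quotientBot

theorem hasNormalPolyFreeChain_one [IsFreeGroup G] : HasNormalPolyFreeChain G 1 := by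
  refine ⟨![⊥, ⊤], isPolyFreeChain_iff.2 ⟨rfl, rfl, fun i => ?_⟩, fun i => ?_⟩
  · obtain rfl := Subsingleton.elim i 0
    have hfree : HasFreeQuotient (⊥ : Subgroup G) ⊤ := hasFreeQuotient_top_iff.2
      ⟨Subgroup.normal_bot, .ofMulEquiv QuotientGroup.quotientBot.symm⟩
    exact hfree
  · fin_cases i
    exacts [Subgroup.normal_bot, Subgroup.normal_top]

theorem hasNormalPolyFreeChain_succ_of_isFreeGroup [IsFreeGroup G] (n : ℕ) :
    HasNormalPolyFreeChain G (n + 1) :=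
  hasNormalPolyFreeChain_one.mono (Nat.le_add_left 1 n)

end Chains

section WreathProducts

variable {A D E H P X : Type*} [Group A] [Group D] [Group E] [Group H] [Group P] [Group X]

theorem exists_equivariant_comp (θ : A →* X) :
    ∃ r : X → A, ∀ a x, θ (r (θ a * x)) = θ a * θ (r x) := by
  obtain ⟨T, hT, -⟩ := θ.range.exists_isComplement_right 1
  choose r hr using fun x => (hT.equiv x).fst.2
  refine ⟨r, fun a x => ?_⟩
  rw [hr, hr, hT.equiv_mul_left_of_mem (θ.mem_range.2 ⟨a, rfl⟩)]
  rfl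

/-- The Kaloujnine–Krasner homomorphism of `A` to the regular wreath product of `θ.ker` by `X`.
Since `θ` need not be surjective, `r` is not a section of `θ`; equivariance of `θ ∘ r` suffices. -/
def kaloujnineKrasner (θ : A →* X) (r : X → A) (hr : ∀ a x, θ (r (θ a * x)) = θ a * θ (r x)) :
    A →* θ.ker ≀ᵣ X where
  toFun a :=
    ⟨fun x => ⟨(r x)⁻¹ * a * r ((θ a)⁻¹ * x), by
      rw [MonoidHom.mem_ker, map_mul, map_mul, ← map_inv θ a, hr, map_inv, map_inv]; group⟩, θ a⟩
  map_one' := by ext <;> simp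
  map_mul' a b := by ext <;> simp [mul_assoc]

/-- The homomorphism of regular wreath products induced by a homomorphism of base groups. -/
def wreathMap (X : Type*) [Group X] (f : D →* E) : D ≀ᵣ X →* E ≀ᵣ X where
  toFun a := ⟨fun x => f (a.left x), a.right⟩
  map_one' := by ext <;> simp
  map_mul' a b := by ext <;> simp

/-- The homomorphism `A → A ≀ᵣ X` given by the constant functions and `θ`. A homomorphism from `A`
to another wreath product by `X` which lifts it remembers every element of `A` in each of its
coordinates. -/
def wreathDiagonal (θ : A →* X) : A →* A ≀ᵣ X where
  toFun a := ⟨fun _ => a, θ a⟩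
  map_one' := by ext <;> simp
  map_mul' a b := by ext <;> simp

theorem exists_injective_ker_of_wreathMap_comp {Θ : H →* X} (Φ : H →* P ≀ᵣ X) (Ψ : P →* H)
    (h : (wreathMap X Ψ).comp Φ = wreathDiagonal Θ) : ∃ f : Θ.ker →* P, Injective f := by
  have hright (a : H) : (Φ a).right = Θ a := congrArg (·.right) (DFunLike.congr_fun h a)
  have hleft (a : H) : Ψ ((Φ a).left 1) = a :=
    congrFun (congrArg (·.left) (DFunLike.congr_fun h a)) 1
  refine ⟨⟨⟨fun a => (Φ a).left 1, by simp⟩, fun a b => ?_⟩, fun a b hab => ?_⟩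
  · have ha : (Φ a).right = 1 := (hright a).trans a.2
    simp [ha]
  · exact Subtype.ext ((hleft a).symm.trans ((congrArg Ψ hab).trans (hleft b)))

theorem exists_injective_ker_coprodI_lift {I : Type*} {G : I → Type*} [∀ i, Group (G i)]
    (θ : ∀ i, G i →* X) {N : ∀ i, Subgroup (G i)} (hN : ∀ i, (θ i).ker = N i) :
    ∃ f : (CoprodI.lift θ).ker →* CoprodI (fun i => N i) ∗ FreeGroup (X × I), Injective f := by
  obtain rfl := funext hN
  choose r hr using fun i => exists_equivariant_comp (θ i)
  let ι (i : I) : (θ i).ker →* CoprodI (fun i => (θ i).ker) ∗ FreeGroup (X × I) :=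
    Coprod.inl.comp (CoprodI.of (M := fun i => (θ i).ker))
  let e (i : I) (x : X) : CoprodI (fun i => (θ i).ker) ∗ FreeGroup (X × I) :=
    Coprod.inr (FreeGroup.of (x, i))
  -- Up to conjugation by `r i`, the map `kaloujnineKrasner (θ i)` is diagonal. Conjugating instead
  -- by free generators, which `Ψ` sends to `r i`, makes the factors agree after applying `Ψ`.
  let Φ : CoprodI G →* (CoprodI (fun i => (θ i).ker) ∗ FreeGroup (X × I)) ≀ᵣ X :=
    CoprodI.lift fun i => (MulAut.conj ⟨e i, 1⟩).toMonoidHom.comp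
      ((wreathMap X (ι i)).comp (kaloujnineKrasner (θ i) (r i) (hr i)))
  let Ψ : CoprodI (fun i => (θ i).ker) ∗ FreeGroup (X × I) →* CoprodI G :=
    Coprod.lift (CoprodI.lift fun i => CoprodI.of.comp (θ i).ker.subtype)
      (FreeGroup.lift fun p => CoprodI.of (r p.2 p.1))
  refine exists_injective_ker_of_wreathMap_comp Φ Ψ (CoprodI.ext_hom _ _ fun i => ?_)
  ext a
  · simp [Φ, Ψ, ι, e, wreathMap, wreathDiagonal, kaloujnineKrasner, mul_assoc]
  · simp [Φ, wreathMap, wreathDiagonal, kaloujnineKrasner]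

end WreathProducts

section FreeProducts

variable {I : Type*} {G H K : I → Type*} [∀ i, Group (G i)] [∀ i, Group (H i)] [∀ i, Group (K i)]

theorem subsingleton_coprodI [∀ i, Subsingleton (G i)] : Subsingleton (CoprodI G) := by
  have hid : MonoidHom.id (CoprodI G) = 1 := CoprodI.ext_hom _ _ fun i => by
    ext a
    simp [Subsingleton.elim a 1]
  exact subsingleton_of_forall_eq 1 (DFunLike.congr_fun hid)

/-- The homomorphism of free products induced by homomorphisms of the factors. -/
def coprodIMap (f : ∀ i, G i →* H i) : CoprodI G →* CoprodI H :=
  CoprodI.lift fun i => CoprodI.of.comp (f i)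

theorem coprodIMap_of (f : ∀ i, G i →* H i) {i : I} (a : G i) :
    coprodIMap f (CoprodI.of a) = CoprodI.of (f i a) :=
  CoprodI.lift_of ..

theorem coprodIMap_comp (g : ∀ i, H i →* K i) (f : ∀ i, G i →* H i) :
    (coprodIMap g).comp (coprodIMap f) = coprodIMap fun i => (g i).comp (f i) :=
  CoprodI.ext_hom _ _ fun i => by
    ext a
    simp [coprodIMap_of]

theorem coprodIMap_id : coprodIMap (fun i => MonoidHom.id (G i)) = .id _ :=
  CoprodI.lift_of'

theorem coprodIMap_injective {f : ∀ i, G i →* H i} {g : ∀ i, H i →* G i}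
    (hgf : ∀ i, LeftInverse (g i) (f i)) : Injective (coprodIMap f) := by
  have hcomp : (coprodIMap g).comp (coprodIMap f) = .id _ := by
    rw [coprodIMap_comp, ← coprodIMap_id]
    exact congrArg coprodIMap (funext fun i => MonoidHom.ext (hgf i))
  exact LeftInverse.injective (DFunLike.congr_fun hcomp)

theorem coprodIMap_surjective {f : ∀ i, G i →* H i} (hf : ∀ i, Surjective (f i)) :
    Surjective (coprodIMap f) := by
  intro a
  induction a using CoprodI.induction_on with
  | one => exact ⟨1, map_one _⟩
  | of i a =>
    obtain ⟨b, rfl⟩ := hf i a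
    exact ⟨CoprodI.of b, coprodIMap_of f b⟩
  | mul a b ha hb =>
    obtain ⟨⟨a, rfl⟩, ⟨b, rfl⟩⟩ := And.intro ha hb
    exact ⟨a * b, map_mul ..⟩

theorem exists_injective_ker_coprodIMap (f : ∀ i, G i →* H i) :
    ∃ φ : (coprodIMap f).ker →* CoprodI (fun i => (f i).ker) ∗ FreeGroup (CoprodI H × I),
      Injective φ := by
  exact exists_injective_ker_coprodI_lift (fun i => CoprodI.of.comp (f i)) fun i =>
    MonoidHom.ker_comp_of_injective _ _ (CoprodI.of_injective i)

/-- The factors of `CoprodI G ∗ B`, as subgroups of it rather than as the groups `G i` and `B`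
themselves, so that they form one family in a single universe. -/
def coprodFactor (G : I → Type*) [∀ i, Group (G i)] (B : Type*) [Group B] :
    Option I → Subgroup (CoprodI G ∗ B)
  | none => (Coprod.inr : B →* CoprodI G ∗ B).range
  | some i => ((Coprod.inl : CoprodI G →* CoprodI G ∗ B).comp (CoprodI.of (i := i))).range

theorem exists_injective_coprodI_coprodFactor (B : Type*) [Group B] :
    ∃ f : CoprodI G ∗ B →* CoprodI fun o => coprodFactor G B o, Injective f := by
  let f : CoprodI G ∗ B →* CoprodI fun o => coprodFactor G B o :=
    Coprod.lift (CoprodI.lift fun i => (CoprodI.of (i := some i)).comp (MonoidHom.rangeRestrict _))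
      ((CoprodI.of (i := none)).comp (MonoidHom.rangeRestrict _))
  let g : (CoprodI fun o => coprodFactor G B o) →* CoprodI G ∗ B :=
    CoprodI.lift fun o => (coprodFactor G B o).subtype
  have hgf : g.comp f = .id _ :=
    Coprod.hom_ext (CoprodI.ext_hom _ _ fun i => rfl) rfl
  exact ⟨f, LeftInverse.injective (DFunLike.congr_fun hgf)⟩

/-- The group `G i` as the member of the family `coprodFactor G B` at the index `some i`. -/
noncomputable def coprodFactorSome (B : Type*) [Group B] (i : I) :
    G i ≃* coprodFactor G B (some i) :=
  MonoidHom.ofInjective (Coprod.inl_injective.comp (CoprodI.of_injective i))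

/-- The group `B` as the member of the family `coprodFactor G B` at the index `none`. -/
noncomputable def coprodFactorNone (G : I → Type*) [∀ i, Group (G i)] (B : Type*) [Group B] :
    B ≃* coprodFactor G B none :=
  MonoidHom.ofInjective Coprod.inr_injective

theorem isFreeGroup_coprodI_coprod [∀ i, IsFreeGroup (G i)] (B : Type*) [Group B]
    [IsFreeGroup B] : IsFreeGroup (CoprodI G ∗ B) := by
  obtain ⟨f, hf⟩ := exists_injective_coprodI_coprodFactor (G := G) B
  have (o : Option I) : IsFreeGroup (coprodFactor G B o) :=
    match o with
    | none => .ofMulEquiv (coprodFactorNone G B)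
    | some i => .ofMulEquiv (coprodFactorSome B i)
  exact isFreeGroup_of_injective f hf

theorem isFreeGroup_ker_coprodIMap {f : ∀ i, G i →* H i} (hf : ∀ i, IsFreeGroup (f i).ker) :
    IsFreeGroup (coprodIMap f).ker := by
  obtain ⟨φ, hφ⟩ := exists_injective_ker_coprodIMap f
  have := isFreeGroup_coprodI_coprod (G := fun i => (f i).ker) (FreeGroup (CoprodI H × I))
  exact isFreeGroup_of_injective φ hφ

theorem hasPolyFreeChain_coprodFactor {B : Type*} [Group B] {n : ℕ}
    (hG : ∀ i, HasPolyFreeChain (G i) n) (hB : HasPolyFreeChain B n) :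
    ∀ o, HasPolyFreeChain (coprodFactor G B o) n
  | none => hB.of_injective (coprodFactorNone G B).symm.toMonoidHom
      (coprodFactorNone G B).symm.injective
  | some i => (hG i).of_injective (coprodFactorSome B i).symm.toMonoidHom
      (coprodFactorSome B i).symm.injective

theorem hasNormalPolyFreeChain_coprodFactor {B : Type*} [Group B] {n : ℕ}
    (hG : ∀ i, HasNormalPolyFreeChain (G i) n) (hB : HasNormalPolyFreeChain B n) :
    ∀ o, HasNormalPolyFreeChain (coprodFactor G B o) n
  | none => hB.of_injective (coprodFactorNone G B).symm.toMonoidHom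
      (coprodFactorNone G B).symm.injective
  | some i => (hG i).of_injective (coprodFactorSome B i).symm.toMonoidHom
      (coprodFactorSome B i).symm.injective

-- The free factor created at each step lives in `Type (max u v)`, so the induction needs the groups
-- `G i` there too.
theorem hasPolyFreeChain_coprodI_succ (n : ℕ) :
    ∀ {I : Type u} {G : I → Type (max u v)} [∀ i, Group (G i)],
      (∀ i, HasPolyFreeChain (G i) (n + 1)) → HasPolyFreeChain (CoprodI G) (n + 1) := by
  induction n with
  | zero =>
    intro I G _ h
    have (i : I) : IsFreeGroup (G i) := (h i).isFreeGroup
    exact (hasNormalPolyFreeChain_succ_of_isFreeGroup 0).hasPolyFreeChain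
  | succ n ih =>
    intro I G _ h
    choose N hN hfree hsub using fun i => hasPolyFreeChain_succ_iff.1 (h i)
    let π (i : I) := QuotientGroup.mk' (N i)
    have hker (i : I) : HasPolyFreeChain (π i).ker (n + 1) := by
      rw [QuotientGroup.ker_mk']
      exact hsub i
    have hfreeFactor :
        HasPolyFreeChain (FreeGroup ((CoprodI fun i => G i ⧸ N i) × I)) (n + 1) :=
      (hasNormalPolyFreeChain_succ_of_isFreeGroup n).hasPolyFreeChain
    obtain ⟨φ, hφ⟩ := exists_injective_ker_coprodIMap π
    obtain ⟨ψ, hψ⟩ := exists_injective_coprodI_coprodFactor (G := fun i => (π i).ker)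
      (FreeGroup ((CoprodI fun i => G i ⧸ N i) × I))
    have hchain := ih (hasPolyFreeChain_coprodFactor hker hfreeFactor)
    exact .of_ker (coprodIMap π) (hchain.of_injective (ψ.comp φ) (hψ.comp hφ))

theorem hasPolyFreeChain_coprodI {I : Type u} {G : I → Type v} [∀ i, Group (G i)] {n : ℕ}
    (h : ∀ i, HasPolyFreeChain (G i) n) : HasPolyFreeChain (CoprodI G) n := by
  cases n with
  | zero =>
    have (i : I) : Subsingleton (G i) := hasPolyFreeChain_zero_iff.1 (h i)
    exact hasPolyFreeChain_zero_iff.2 subsingleton_coprodI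
  | succ n =>
    let up (i : I) : G i ≃* ULift.{u} (G i) := MulEquiv.ulift.symm
    have hup (i : I) : HasPolyFreeChain (ULift.{u} (G i)) (n + 1) :=
      (h i).of_injective (up i).symm.toMonoidHom (up i).symm.injective
    exact (hasPolyFreeChain_coprodI_succ.{u, v} n hup).of_injective
      (coprodIMap fun i => (up i).toMonoidHom)
      (coprodIMap_injective (g := fun i => (up i).symm.toMonoidHom) fun i => (up i).left_inv)

theorem hasPolyFreeChain_coprodI_coprod {B : Type*} [Group B] {n : ℕ}
    (hG : ∀ i, HasPolyFreeChain (G i) n) (hB : HasPolyFreeChain B n) :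
    HasPolyFreeChain (CoprodI G ∗ B) n :=
  let ⟨f, hf⟩ := exists_injective_coprodI_coprodFactor (G := G) B
  (hasPolyFreeChain_coprodI (hasPolyFreeChain_coprodFactor hG hB)).of_injective f hf

theorem hasFreeQuotient_ker_coprodIMap_mk' {A B : ∀ i, Subgroup (G i)} [∀ i, (A i).Normal]
    [∀ i, (B i).Normal] (h : ∀ i, HasFreeQuotient (A i) (B i)) :
    HasFreeQuotient (coprodIMap fun i => QuotientGroup.mk' (A i)).ker
      (coprodIMap fun i => QuotientGroup.mk' (B i)).ker := by
  let g (i : I) : G i ⧸ A i →* G i ⧸ B i := QuotientGroup.map _ _ (.id _) (h i).1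
  have hg (i : I) : (g i).comp (QuotientGroup.mk' (A i)) = QuotientGroup.mk' (B i) := rfl
  have hfree (i : I) : IsFreeGroup (g i).ker := by
    rw [← hasFreeQuotient_ker_comp_iff (QuotientGroup.mk'_surjective (A i)), hg,
      QuotientGroup.ker_mk', QuotientGroup.ker_mk']
    exact h i
  have hcomp : (coprodIMap g).comp (coprodIMap fun i => QuotientGroup.mk' (A i)) =
      coprodIMap fun i => QuotientGroup.mk' (B i) :=
    coprodIMap_comp ..
  rw [← hcomp, hasFreeQuotient_ker_comp_iff
    (coprodIMap_surjective fun i => QuotientGroup.mk'_surjective (A i))]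
  exact isFreeGroup_ker_coprodIMap hfree

theorem hasNormalPolyFreeChain_coprodI {n : ℕ} (h : ∀ i, HasNormalPolyFreeChain (G i) n) :
    HasNormalPolyFreeChain (CoprodI G) n := by
  choose C hC hN using h
  refine ⟨fun k => (coprodIMap fun i => QuotientGroup.mk' (C i k)).ker, isPolyFreeChain_iff.2
    ⟨?_, ?_, fun k => hasFreeQuotient_ker_coprodIMap_mk' fun i =>
      (isPolyFreeChain_iff.1 (hC i)).2.2 k⟩, fun k => inferInstance⟩
  · rw [MonoidHom.ker_eq_bot_iff]
    exact coprodIMap_injective (g := fun i => QuotientGroup.lift _ (.id _) (hC i).1.le)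
      fun i a => rfl
  · have (i : I) : Subsingleton (G i ⧸ C i (Fin.last n)) :=
      QuotientGroup.subsingleton_iff.2 (hC i).2.1
    have : Subsingleton (CoprodI fun i => G i ⧸ C i (Fin.last n)) := subsingleton_coprodI
    exact eq_top_iff.2 fun a _ => Subsingleton.elim _ _

theorem hasNormalPolyFreeChain_coprodI_coprod {B : Type*} [Group B] {n : ℕ}
    (hG : ∀ i, HasNormalPolyFreeChain (G i) n) (hB : HasNormalPolyFreeChain B n) :
    HasNormalPolyFreeChain (CoprodI G ∗ B) n :=
  let ⟨f, hf⟩ := exists_injective_coprodI_coprodFactor (G := G) B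
  (hasNormalPolyFreeChain_coprodI (hasNormalPolyFreeChain_coprodFactor hG hB)).of_injective f hf

theorem exists_finiteIndex_injective [Finite I] (N : ∀ i, Subgroup (G i)) [∀ i, (N i).Normal]
    [∀ i, (N i).FiniteIndex] :
    ∃ D : Subgroup (CoprodI G), D.FiniteIndex ∧
      ∃ f : D →* CoprodI (fun i => N i) ∗ FreeGroup ((∀ i, G i ⧸ N i) × I), Injective f := by
  classical
  let θ (i : I) : G i →* ∀ i, G i ⧸ N i :=
    (MonoidHom.mulSingle (fun i => G i ⧸ N i) i).comp (QuotientGroup.mk' (N i))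
  have hθ (i : I) : (θ i).ker = N i :=
    (MonoidHom.ker_comp_of_injective _ _ (Pi.mulSingle_injective (M := fun i => G i ⧸ N i) i)).trans
      (QuotientGroup.ker_mk' _)
  exact ⟨(CoprodI.lift θ).ker, inferInstance, exists_injective_ker_coprodI_lift θ hθ⟩

theorem isVirtuallyPolyFree_coprodI [Finite I] (h : ∀ i, IsVirtuallyPolyFree (G i)) :
    IsVirtuallyPolyFree (CoprodI G) := by
  choose K hK n hn using h
  obtain ⟨m, hm⟩ := (Set.finite_range n).bddAbove
  have hcore (i : I) : HasPolyFreeChain (K i).normalCore (m + 1) :=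
    ((hn i).mono ((hm ⟨i, rfl⟩).trans m.le_succ)).of_injective _
      (Subgroup.inclusion_injective (K i).normalCore_le)
  obtain ⟨D, hD, f, hf⟩ := exists_finiteIndex_injective fun i => (K i).normalCore
  exact ⟨D, hD, m + 1, (hasPolyFreeChain_coprodI_coprod hcore
    (hasNormalPolyFreeChain_succ_of_isFreeGroup m).hasPolyFreeChain).of_injective f hf⟩

theorem isVirtuallyNormallyPolyFree_coprodI [Finite I]
    (h : ∀ i, IsVirtuallyNormallyPolyFree (G i)) :
    IsVirtuallyNormallyPolyFree (CoprodI G) := by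
  choose K hK n hn using h
  obtain ⟨m, hm⟩ := (Set.finite_range n).bddAbove
  have hcore (i : I) : HasNormalPolyFreeChain (K i).normalCore (m + 1) :=
    ((hn i).mono ((hm ⟨i, rfl⟩).trans m.le_succ)).of_injective _
      (Subgroup.inclusion_injective (K i).normalCore_le)
  obtain ⟨D, hD, f, hf⟩ := exists_finiteIndex_injective fun i => (K i).normalCore
  exact ⟨D, hD, m + 1, (hasNormalPolyFreeChain_coprodI_coprod hcore
    (hasNormalPolyFreeChain_succ_of_isFreeGroup m)).of_injective f hf⟩

end FreeProducts

theorem mainTheorem6 {I : Type*} (G : I → Type*) [∀ i, Group (G i)] :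
    (∀ n : ℕ, (∀ i, IsPolyFree (G i) ∧ polyFreeLength (G i) ≤ n) →
      IsPolyFree (Monoid.CoprodI G) ∧ polyFreeLength (Monoid.CoprodI G) ≤ n) ∧
    (∀ n : ℕ, (∀ i, IsNormallyPolyFree (G i) ∧ normallyPolyFreeLength (G i) ≤ n) →
      IsNormallyPolyFree (Monoid.CoprodI G) ∧
        normallyPolyFreeLength (Monoid.CoprodI G) ≤ n) ∧
    (Finite I → (∀ i, IsVirtuallyPolyFree (G i)) →
      IsVirtuallyPolyFree (Monoid.CoprodI G)) ∧
    (Finite I → (∀ i, IsVirtuallyNormallyPolyFree (G i)) →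
      IsVirtuallyNormallyPolyFree (Monoid.CoprodI G)) := by
  exact ⟨
    fun n h => isPolyFree_and_polyFreeLength_le_iff.2 (hasPolyFreeChain_coprodI fun i =>
      isPolyFree_and_polyFreeLength_le_iff.1 (h i)),
    fun n h => isNormallyPolyFree_and_normallyPolyFreeLength_le_iff.2
      (hasNormalPolyFreeChain_coprodI fun i =>
        isNormallyPolyFree_and_normallyPolyFreeLength_le_iff.1 (h i)),
    fun _ h => isVirtuallyPolyFree_coprodI h,
    fun _ h => isVirtuallyNormallyPolyFree_coprodI h⟩
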